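/- Let $K$ be a totally real number field of degree $d$ over $\mathbb{Q}$ with ring of integers $\mathcal{O}_K$, and let $S$ be the set of the $d$ field embeddings $K\hookrightarrow\mathbb{R}$. Let $\mathbf{r}=(r_\sigma)_{\sigma\in S}$ be a real vector with $r_\sigma\ge 0$ for all $\sigma\in S$ and $\sum_{\sigma\in S}r_\sigma=1$; put $S_1=\{\sigma\in S: r_\sigma>0\}$, $S_2=S\setminus S_1$, and, for $q\in K$, $\|q\|_{\mathbf{r}}=\max_{\sigma\in S_1}|\sigma(q)|^{1/r_\sigma}$. A vector $\mathbf{x}=(x_\sigma)_{\sigma\in S}\in\prod_{\sigma\in S}\mathbb{R}$ is called $(K,\mathbf{r})$-badly approximable if $$\inf_{\substack{q\in\mathcal{O}_K\setminus\{0\}\\ p\in\mathcal{O}_K}}\max\left\{\max_{\sigma\in S_1}\|q\|_{\mathbf{r}}^{r_\sigma}|\sigma(q)x_\sigma+\sigma(p)|,\ \max_{\sigma\in S_2}\max\{|\sigma(q)x_\sigma+\sigma(p)|,|\sigma(q)|\}\right\}>0$$ (the maximum over $S_2$ is omitted if $S_2=\emptyset$), and $\mathbf{Bad}(K,\mathbf{r})$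 denotes the set of these vectors. Let $G=\prod_{\sigma\in S}\mathrm{SL}_2(\mathbb{R})$, let $\Gamma\subset G$ be the image of $\mathrm{SL}_2(\mathcal{O}_K)$ under $g\mapsto(\sigma(g))_{\sigma\in S}$, and let $\pi:G\to G/\Gamma$ be the projection. Let $$g_{\mathbf{r}}(t)=\left(\begin{pmatrix}e^{r_\sigma t}&0\\0&e^{-r_\sigma t}\end{pmatrix}\right)_{\sigma\in S},\qquad F_{\mathbf{r}}^+=\{g_{\mathbf{r}}(t):t\ge 0\},\qquad u(\mathbf{x})=\left(\begin{pmatrix}1&x_\sigma\\0&1\end{pmatrix}\right)_{\sigma\in S}.$$ A subset of $G/\Gamma$ is called bounded if its closure is compact, and $E(F_{\mathbf{r}}^+)=\{y\in G/\Gamma: F_{\mathbf{r}}^+y\text{ is bounded}\}$. Then a vector $\mathbf{x}\in\prod_{\sigma\in S}\mathbb{R}$ is $(K,\mathbf{r})$-badly approximable if and only if the trajectory $F_{\mathbf{r}}^+u(\mathbf{x})\Gamma$ is bounded in $G/\Gamma$. In other words, $$\mathbf{Bad}(K,\mathbf{r})=u^{-1}\big(\pi^{-1}(E(F_{\mathbf{r}}^+))\cap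 H\big),$$ where $H=u\big(\prod_{\sigma\in S}\mathbb{R}\big)$. If $r_\sigma>0$ for all $\sigma\in S$, the same equality holds with $H$ the expanding horospherical subgroup $\{h\in G:\lim_{t\to+\infty}g_{\mathbf{r}}(t)^{-1}hg_{\mathbf{r}}(t)=e\}$ of $F_{\mathbf{r}}^+$. -/

import Mathlib

open NumberField Matrix Filter Topology

noncomputable section

namespace DaniCorrespondence

variable (K : Type*) [Field K]

/-- The product of copies of `ℝ`, indexed by the set `S` of field embeddings `K ↪ ℝ`. -/
abbrev RealSpace : Type _ := (K →+* ℝ) → ℝ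

/-- `G = ∏_{σ ∈ S} SL₂(ℝ)`, with the product topology. -/
abbrev G : Type _ := (K →+* ℝ) → SpecialLinearGroup (Fin 2) ℝ

variable {K}

/-- `θ : K → ∏_σ ℝ`, `θ(p) = (σ(p))_σ`. -/
def theta (p : K) : RealSpace K := fun σ => σ p

variable (K)

/-- The group homomorphism `θ : SL₂(𝒪_K) → G`, `θ(g) = (σ(g))_σ`. -/
def thetaSL : SpecialLinearGroup (Fin 2) (𝓞 K) →* G K :=
  MonoidHom.pi fun σ => SpecialLinearGroup.map (σ.comp (algebraMap (𝓞 K) K))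

/-- `Γ = θ(SL₂(𝒪_K))`, a subgroup of `G`. -/
def Gam : Subgroup (G K) := (thetaSL K).range

variable {K}

/-- `g_r(t) = (diag(e^{r_σ t}, e^{-r_σ t}))_σ`. -/
def flow (r : RealSpace K) (t : ℝ) : G K := fun σ =>
  ⟨!![Real.exp (r σ * t), 0; 0, Real.exp (-(r σ * t))], by
    simp [Matrix.det_fin_two, ← Real.exp_add]⟩

/-- `F_r⁺ = {g_r(t) : t ≥ 0}`. -/
def semiflow (r : RealSpace K) : Set (G K) := {g | ∃ t : ℝ, 0 ≤ t ∧ g = flow r t}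

/-- `u(x)`: the upper unipotent element of `G` with entries `x_σ`. -/
def unip (x : RealSpace K) : G K := fun σ =>
  ⟨!![1, x σ; 0, 1], by simp [Matrix.det_fin_two]⟩

/-- The expanding horospherical subgroup of `F_r⁺`,
`{h : g_r(t)⁻¹ h g_r(t) → e as t → +∞}`. -/
def horospherical (r : RealSpace K) : Set (G K) :=
  {h | Tendsto (fun t : ℝ => (flow r t)⁻¹ * h * flow r t) atTop (𝓝 1)}

/-- The trajectory `F y = {g y : g ∈ F}` of a point `y ∈ G/Γ` under a subset `F` of `G`. -/
def trajectory (F : Set (G K)) (y : G K ⧸ Gam K) : Set (G K ⧸ Gam K) :=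
  (fun g => g • y) '' F

/-- A subset of a topological space is called bounded if it is relatively compact. -/
def IsBoundedSet {X : Type*} [TopologicalSpace X] (A : Set X) : Prop := IsCompact (closure A)

/-- `E(F)`: the set of points of `G/Γ` whose trajectory under `F` is bounded. -/
def boundedPoints (F : Set (G K)) : Set (G K ⧸ Gam K) := {y | IsBoundedSet (trajectory F y)}

/-- The projection `π : G → G/Γ`. -/
def proj (g : G K) : G K ⧸ Gam K := QuotientGroup.mk g

/-- The `r`-norm `‖x‖_r = max_{σ ∈ S₁} |x_σ|^{1/r_σ}`, where `S₁ = {σ : r_σ > 0}`. -/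
def rNorm (r x : RealSpace K) : ℝ := ⨆ σ : {σ : K →+* ℝ // 0 < r σ}, |x σ| ^ (1 / r σ)

/-- The quantity whose infimum over `p, q` decides whether `x` is badly approximable:
`max { max_{σ ∈ S₁} ‖q‖_r^{r_σ} |σ(q) x_σ + σ(p)|,
  max_{σ ∈ S₂} max {|σ(q) x_σ + σ(p)|, |σ(q)|} }`,
with `S₁ = {σ : r_σ > 0}` and `S₂ = S \ S₁`. All terms are nonnegative and there are finitely many
of them, so a supremum is a maximum, and the supremum over an empty `S₂` (which is `0`) has no
effect. -/
def approxSize (r x : RealSpace K) (p q : 𝓞 K) : ℝ :=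
  max
    (⨆ σ : {σ : K →+* ℝ // 0 < r σ},
      rNorm r (theta (q : K)) ^ r σ * |σ.1 (q : K) * x σ + σ.1 (p : K)|)
    (⨆ σ : {σ : K →+* ℝ // ¬ 0 < r σ},
      max |σ.1 (q : K) * x σ + σ.1 (p : K)| |σ.1 (q : K)|)

/-- `x` is `(K, r)`-badly approximable: the infimum over `p ∈ 𝒪_K` and `q ∈ 𝒪_K \ {0}` is
positive. -/
def IsBadlyApproximable (r x : RealSpace K) : Prop :=
  0 < ⨅ pq : 𝓞 K × {q : 𝓞 K // q ≠ 0}, approxSize r x pq.1 pq.2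

/-- `Bad(K, r)`, the set of `(K, r)`-badly approximable vectors. -/
def Bad (r : RealSpace K) : Set (RealSpace K) := {x | IsBadlyApproximable r x}

end DaniCorrespondence

end

noncomputable section

namespace DaniCorrespondence

/-! ### Conjugates of integers in a totally real field. -/

section Embeddings

variable {K : Type*} [Field K] [NumberField.IsTotallyReal K]

/-! By Mahler's criterion (`isBoundedSet_iff_exists_systole`), the trajectory of `u(x)Γ` is bounded
iff the nonzero vectors of the lattices `g_r(t) u(x) 𝒪_K²`, `t ≥ 0`, stay away from `0` uniformly in
`t`. The vector `(p, q)` has coordinates `e^{r_σ t}(σ(q)x_σ + σ(p))` and `e^{-r_σ t}σ(q)`. If all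
are below `ε ≤ 1`, then `‖q‖_r ≤ e^t` and the approximation quantity is at most `ε`
(`approxSize_le_of_short`). Conversely, for given `q`, the time `e^t = A‖q‖_r` with `A` large makes
the second coordinates over `S₁` small, so another coordinate must be large
(`exists_approxSize_of_systole`).

Mahler's criterion rests on Minkowski's theorem with one constant for all `g ∈ G`. Applied to `g
𝒪_K²` and then to a stretched copy, it gives two short vectors `v`, `w` with `δ = det(v, w) ≠ 0`.
Only finitely many `δ` occur, and for each only finitely many classes of `(v, w)` modulo `δ`.
Matrices of determinant `δ` in one class differ by `SL₂(𝒪_K)`, so finitely many reference matrices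
bound a representative of `gΓ` (`exists_bounded_representative`). -/

/-- Every complex embedding of a totally real field is real. -/
theorem exists_real_embedding (φ : K →+* ℂ) : ∃ σ : K →+* ℝ, ∀ x, φ x = (σ x : ℂ) := by
  have h := NumberField.IsTotallyReal.complexEmbedding_isReal φ
  exact ⟨h.embedding, fun x => (h.coe_embedding_apply x).symm⟩

variable [NumberField K]

theorem card_real_embedding :
    Fintype.card (K →+* ℝ) = Module.finrank ℚ K := by
  rw [← NumberField.Embeddings.card K ℂ]
  refine Fintype.card_of_bijective (f := fun σ : K →+* ℝ => Complex.ofRealHom.comp σ) ⟨?_, ?_⟩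
  · intro σ τ h
    ext x
    have := RingHom.congr_fun h x
    simpa using this
  · intro φ
    obtain ⟨σ, hσ⟩ := exists_real_embedding φ
    exact ⟨σ, by ext x; simp [hσ]⟩

/-- A nonzero algebraic integer has a conjugate of absolute value at least `1`. -/
theorem exists_one_le_abs {a : 𝓞 K} (ha : a ≠ 0) : ∃ σ : K →+* ℝ, 1 ≤ |σ (a : K)| := by
  by_contra! h
  have hw : ∀ w : InfinitePlace K, w (a : K) < 1 := by
    intro w
    obtain ⟨σ, hσ⟩ := exists_real_embedding w.embedding
    rw [← w.norm_embedding_eq, hσ, Complex.norm_real]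
    exact h σ
  have w : InfinitePlace K := Classical.arbitrary _
  exact absurd (InfinitePlace.one_le_of_lt_one (w := w) ha fun z _ => hw z) (not_le.2 (hw w))

/-- There are finitely many algebraic integers with bounded conjugates. -/
theorem finite_abs_le (B : ℝ) : {a : 𝓞 K | ∀ σ : K →+* ℝ, |σ (a : K)| ≤ B}.Finite := by
  refine Set.Finite.of_finite_image (f := fun a : 𝓞 K => (a : K)) ?_
    (RingOfIntegers.coe_injective.injOn)
  refine (NumberField.Embeddings.finite_of_norm_le K ℂ B).subset ?_
  rintro _ ⟨a, ha, rfl⟩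
  refine ⟨a.isIntegral_coe, fun φ => ?_⟩
  obtain ⟨σ, hσ⟩ := exists_real_embedding φ
  rw [hσ, Complex.norm_real]
  exact ha σ

/-- Complex independence of the canonically embedded integral basis suffices, as each complex
embedding factors through `ℝ`. -/
theorem integralBasis_real_independent (c : Module.Free.ChooseBasisIndex ℤ (𝓞 K) → ℝ)
    (h : ∀ σ : K →+* ℝ, ∑ k, c k * σ (integralBasis K k) = 0) : c = 0 := by
  have hli := (canonicalEmbedding.latticeBasis K).linearIndependent
  rw [Fintype.linearIndependent_iff] at hli
  have := hli (fun k => (c k : ℂ)) (by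
    ext φ
    obtain ⟨σ, hσ⟩ := exists_real_embedding φ
    have h' := congrArg (fun z : ℝ => (z : ℂ)) (h σ)
    simp only [Complex.ofReal_sum, Complex.ofReal_mul, Complex.ofReal_zero] at h'
    simpa [Finset.sum_apply, hσ] using h')
  ext k
  simpa using this k

end Embeddings

/-! ### Minkowski's theorem, uniformly over `G`. -/

section Minkowski

variable {K : Type*} [Field K]

/-- The vector `g v` in `∏_σ ℝ²`, for `g ∈ G` and `v ∈ 𝒪_K²`. -/
def latticeVec (g : G K) (v : Fin 2 → 𝓞 K) (σ : K →+* ℝ) : Fin 2 → ℝ :=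
  (g σ).1 *ᵥ fun j => σ (v j : K)

theorem latticeVec_apply (g : G K) (v : Fin 2 → 𝓞 K) (σ : K →+* ℝ) (i : Fin 2) :
    latticeVec g v σ i = (g σ).1 i 0 * σ (v 0 : K) + (g σ).1 i 1 * σ (v 1 : K) := by
  simp [latticeVec, Matrix.mulVec, dotProduct, Fin.sum_univ_two]

theorem latticeVec_mul (h g : G K) (v : Fin 2 → 𝓞 K) (σ : K →+* ℝ) :
    latticeVec (h * g) v σ = (h σ).1 *ᵥ latticeVec g v σ := by
  simp only [latticeVec, Matrix.mulVec_mulVec]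
  rfl

variable (K) in
/-- The embedding of `𝒪_K²` into `∏_σ ℝ²`. -/
def latticeMap : (Fin 2 → 𝓞 K) →ₗ[ℤ] ((K →+* ℝ) → Fin 2 → ℝ) where
  toFun v σ i := σ (v i : K)
  map_add' v w := by ext; simp
  map_smul' n v := by ext; simp

theorem measurePreserving_mulVec (A : SpecialLinearGroup (Fin 2) ℝ) :
    MeasureTheory.MeasurePreserving (fun v : Fin 2 → ℝ => A.1 *ᵥ v) := by
  refine ⟨(Matrix.mulVecLin A.1).continuous_of_finiteDimensional.measurable, ?_⟩
  have := Real.map_matrix_volume_pi_eq_smul_volume_pi (M := A.1) (by simp [A.2])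
  rw [A.2, inv_one, abs_one, ENNReal.ofReal_one, one_smul, Matrix.toLin'_apply'] at this
  exact this

variable [NumberField K] [NumberField.IsTotallyReal K]

/-- Minkowski's theorem only needs a full-rank lattice inside the image of `𝒪_K²`, so it is not
shown that `b` spans that image over `ℤ`. -/
theorem exists_lattice_basis : ∃ b : Module.Basis
    (Module.Free.ChooseBasisIndex ℤ (𝓞 K) × Fin 2) ℝ ((K →+* ℝ) → Fin 2 → ℝ),
    ∀ k, b k ∈ LinearMap.range (latticeMap K) := by
  classical
  let f : Module.Free.ChooseBasisIndex ℤ (𝓞 K) × Fin 2 → ((K →+* ℝ) → Fin 2 → ℝ) := fun k =>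
    latticeMap K (Pi.single k.2 (RingOfIntegers.basis K k.1))
  have hf : ∀ k σ i, f k σ i = if i = k.2 then σ (integralBasis K k.1) else 0 := by
    intro k σ i
    simp only [f, latticeMap, LinearMap.coe_mk, AddHom.coe_mk, Pi.single_apply]
    split_ifs <;> simp [integralBasis_apply]
  have hli : LinearIndependent ℝ f := by
    rw [Fintype.linearIndependent_iff]
    rintro c hc ⟨k, i⟩
    have := integralBasis_real_independent (fun k => c (k, i)) (fun σ => by
      have := congrFun (congrFun hc σ) i
      simpa [Finset.sum_apply, hf, Fintype.sum_prod_type] using this)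
    exact congrFun this k
  have hcard : Fintype.card (Module.Free.ChooseBasisIndex ℤ (𝓞 K) × Fin 2) =
      Module.finrank ℝ ((K →+* ℝ) → Fin 2 → ℝ) := by
    rw [Fintype.card_prod, Module.finrank_pi_fintype]
    simp only [Module.finrank_fintype_fun_eq_card, Fintype.card_fin, Finset.sum_const,
      Finset.card_univ, smul_eq_mul]
    rw [card_real_embedding, ← Module.finrank_eq_card_chooseBasisIndex, RingOfIntegers.rank]
  refine ⟨basisOfLinearIndependentOfCardEqFinrank hli hcard, fun k => ?_⟩
  rw [coe_basisOfLinearIndependentOfCardEqFinrank]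
  exact ⟨_, rfl⟩

variable (K) in
/-- Minkowski's theorem, uniformly for all the lattices `g 𝒪_K²` with `g ∈ G`. -/
theorem exists_short_vector : ∃ C : ℝ, 0 < C ∧ ∀ g : G K, ∃ v : Fin 2 → 𝓞 K, v ≠ 0 ∧
    ∀ σ i, |latticeVec g v σ i| ≤ C := by
  classical
  obtain ⟨b, hb⟩ := exists_lattice_basis (K := K)
  have : Nonempty (K →+* ℝ) := (exists_one_le_abs (K := K) one_ne_zero).nonempty
  let E := (K →+* ℝ) → Fin 2 → ℝ
  let μ : MeasureTheory.Measure E := MeasureTheory.volume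
  have hfin : μ (ZSpan.fundamentalDomain b) * 2 ^ Module.finrank ℝ E < ⊤ :=
    ENNReal.mul_lt_top (ZSpan.fundamentalDomain_isBounded b).measure_lt_top (by finiteness)
  -- The space is nonzero, so it has infinite volume and large balls exceed the Minkowski bound.
  obtain ⟨n, hn⟩ : ∃ n : ℕ, μ (ZSpan.fundamentalDomain b) * 2 ^ Module.finrank ℝ E <
      μ (Metric.closedBall 0 n) := by
    rw [← lt_iSup_iff, ← Monotone.measure_iUnion, Metric.iUnion_closedBall_nat,
      MeasureTheory.measure_univ_of_isAddLeftInvariant]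
    · exact hfin
    · exact fun m n h => Metric.closedBall_subset_closedBall (by exact_mod_cast h)
  refine ⟨n + 1, by positivity, fun g => ?_⟩
  -- The lattice stays fixed and the ball is pulled back by `g`. Volume is preserved since each
  -- factor has determinant one, so the radius does not depend on `g`.
  let T : E →ₗ[ℝ] E := LinearMap.pi fun σ => (Matrix.mulVecLin (g σ).1) ∘ₗ LinearMap.proj σ
  have hT : MeasureTheory.MeasurePreserving T :=
    MeasureTheory.volume_preserving_pi fun σ => measurePreserving_mulVec (g σ)
  have hvol : μ (T ⁻¹' Metric.closedBall 0 n) = μ (Metric.closedBall 0 n) :=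
    hT.measure_preimage Metric.isClosed_closedBall.measurableSet.nullMeasurableSet
  have : Countable (Submodule.span ℤ (Set.range b)).toAddSubgroup :=
    inferInstanceAs (Countable (Submodule.span ℤ (Set.range b)))
  obtain ⟨⟨x, hxL⟩, hx0, hx⟩ :=
    MeasureTheory.exists_ne_zero_mem_lattice_of_measure_mul_two_pow_lt_measure
      (μ := μ) (s := T ⁻¹' Metric.closedBall 0 n)
      (ZSpan.isAddFundamentalDomain' b μ) (by intro x hx; simpa using hx)
      ((convex_closedBall 0 _).linear_preimage T) (by rw [hvol]; exact hn)
  have hle : Submodule.span ℤ (Set.range b) ≤ LinearMap.range (latticeMap K) := by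
    rw [Submodule.span_le]
    rintro _ ⟨k, rfl⟩
    exact hb k
  obtain ⟨v, rfl⟩ := hle hxL
  refine ⟨v, ?_, fun σ i => ?_⟩
  · rintro rfl
    exact hx0 (by simp)
  · rw [Set.mem_preimage, mem_closedBall_zero_iff] at hx
    have h1 := (norm_le_pi_norm (T (latticeMap K v)) σ).trans hx
    have h2 := (norm_le_pi_norm _ i).trans h1
    exact h2.trans (by linarith)

end Minkowski

/-! ### Bounded representatives of lattices with bounded below systole. -/

section Mahler

/-- For a nonzero vector `z` of the plane and `s > 0`, there is an element of `SL₂(ℝ)` that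
multiplies by `s` the component along `z`, and by `1 / s` the orthogonal component. -/
theorem exists_stretch (z : Fin 2 → ℝ) (hz : z ≠ 0) {s : ℝ} (hs : 0 < s) :
    ∃ A : SpecialLinearGroup (Fin 2) ℝ, ∀ (y : Fin 2 → ℝ) (C : ℝ), (∀ i, |(A.1 *ᵥ y) i| ≤ C) →
      (∀ i, |y i| ≤ C / s + C * s) ∧ (z 0 * y 1 - z 1 * y 0 = 0 → ∀ i, |y i| ≤ C / s) := by
  have hpos : 0 < z 0 ^ 2 + z 1 ^ 2 := by
    by_contra! h
    have h0 : z 0 = 0 := pow_eq_zero_iff two_ne_zero |>.1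
      (by nlinarith [sq_nonneg (z 0), sq_nonneg (z 1)])
    have h1 : z 1 = 0 := pow_eq_zero_iff two_ne_zero |>.1
      (by nlinarith [sq_nonneg (z 0), sq_nonneg (z 1)])
    exact hz (funext fun i => by fin_cases i <;> assumption)
  obtain ⟨n, hn, hn2⟩ : ∃ n : ℝ, 0 < n ∧ n ^ 2 = z 0 ^ 2 + z 1 ^ 2 :=
    ⟨_, Real.sqrt_pos.2 hpos, Real.sq_sqrt hpos.le⟩
  obtain ⟨c, hc⟩ : ∃ c, z 0 = n * c := ⟨z 0 / n, by field_simp⟩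
  obtain ⟨d, hd⟩ : ∃ d, z 1 = n * d := ⟨z 1 / n, by field_simp⟩
  have hcd : c ^ 2 + d ^ 2 = 1 := by
    have : n ^ 2 * (c ^ 2 + d ^ 2) = n ^ 2 * 1 := by
      rw [mul_one, mul_add, ← mul_pow, ← mul_pow, ← hc, ← hd, hn2]
    exact mul_left_cancel₀ (by positivity) this
  have hc1 : |c| ≤ 1 := abs_le_one_iff_mul_self_le_one.2 (by nlinarith [sq_nonneg d])
  have hd1 : |d| ≤ 1 := abs_le_one_iff_mul_self_le_one.2 (by nlinarith [sq_nonneg c])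
  -- The rows are `s` times the unit vector along `z` and `1 / s` times its rotation by a right
  -- angle.
  refine ⟨⟨!![s * c, s * d; -(d / s), c / s], ?_⟩, fun y C hy => ?_⟩
  · rw [Matrix.det_fin_two_of, ← hcd]
    field_simp
    ring
  obtain ⟨a, ha⟩ : ∃ a, a = c * y 0 + d * y 1 := ⟨_, rfl⟩
  obtain ⟨b, hb⟩ : ∃ b, b = c * y 1 - d * y 0 := ⟨_, rfl⟩
  have h0 : |a| ≤ C / s := by
    have : |a| * s = |a * s| := by rw [abs_mul, abs_of_pos hs]
    rw [le_div_iff₀ hs, this]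
    refine le_of_eq_of_le (congrArg _ ?_) (hy 0)
    simp only [Matrix.mulVec, dotProduct, Fin.sum_univ_two, ha, Matrix.of_apply,
      Matrix.cons_val_zero, Matrix.cons_val_one]
    ring
  have h1 : |b| ≤ C * s := by
    have : |b| / s = |b / s| := by rw [abs_div, abs_of_pos hs]
    rw [← div_le_iff₀ hs, this]
    refine le_of_eq_of_le (congrArg _ ?_) (hy 1)
    simp only [Matrix.mulVec, dotProduct, Fin.sum_univ_two, hb, Matrix.of_apply,
      Matrix.cons_val_zero, Matrix.cons_val_one]
    ring
  have hy0 : y 0 = c * a - d * b := by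
    rw [ha, hb]; linear_combination (-y 0) * hcd
  have hy1 : y 1 = d * a + c * b := by
    rw [ha, hb]; linear_combination (-y 1) * hcd
  have key : ∀ p q : ℝ, |p| ≤ 1 → |q| ≤ 1 → |p * a + q * b| ≤ |a| + |b| := by
    intro p q hp hq
    refine (abs_add_le _ _).trans ?_
    rw [abs_mul, abs_mul]
    exact add_le_add (mul_le_of_le_one_left (abs_nonneg _) hp)
      (mul_le_of_le_one_left (abs_nonneg _) hq)
  have hsum : ∀ i, |y i| ≤ |a| + |b| := by
    intro i
    fin_cases i
    · simpa [hy0, sub_eq_add_neg] using key c (-d) hc1 (by rwa [abs_neg])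
    · simpa [hy1] using key d c hd1 hc1
  refine ⟨fun i => (hsum i).trans (add_le_add h0 h1), fun h i => ?_⟩
  have hb0 : b = 0 := by
    have : n * b = n * 0 := by rw [hb]; rw [hc, hd] at h; linear_combination h
    exact mul_left_cancel₀ hn.ne' this
  have := hsum i
  rw [hb0, abs_zero, add_zero] at this
  exact this.trans h0

variable {K : Type*} [Field K]

/-- The set of `g ∈ G` such that all nonzero vectors of `g 𝒪_K²` have sup norm at least `ε`. -/
def systoleSet (K : Type*) [Field K] (ε : ℝ) : Set (G K) :=
  {g | ∀ v : Fin 2 → 𝓞 K, v ≠ 0 → ∃ σ i, ε ≤ |latticeVec g v σ i|}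

theorem latticeVec_det (g : G K) (v w : Fin 2 → 𝓞 K) (σ : K →+* ℝ) :
    latticeVec g v σ 0 * latticeVec g w σ 1 - latticeVec g v σ 1 * latticeVec g w σ 0 =
      σ ((v 0 * w 1 - v 1 * w 0 : 𝓞 K) : K) := by
  have hdet := (g σ).2
  rw [Matrix.det_fin_two] at hdet
  simp only [latticeVec_apply]
  push_cast
  simp only [map_sub, map_mul]
  linear_combination (σ (v 0 : K) * σ (w 1 : K) - σ (v 1 : K) * σ (w 0 : K)) * hdet

theorem latticeVec_ne_zero (g : G K) {v : Fin 2 → 𝓞 K} (hv : v ≠ 0) (σ : K →+* ℝ) :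
    latticeVec g v σ ≠ 0 := by
  intro h
  apply hv
  have h2 : (fun j => σ (v j : K)) = 0 := by
    apply Matrix.eq_zero_of_mulVec_eq_zero (M := (g σ).1) _ h
    rw [(g σ).2]
    exact one_ne_zero
  funext j
  have := congrFun h2 j
  simpa using this

section

variable [NumberField K] [NumberField.IsTotallyReal K]

theorem exists_independent_short_vectors {ε : ℝ} (hε : 0 < ε) :
    ∃ R : ℝ, ∀ g ∈ systoleSet K ε, ∃ v w : Fin 2 → 𝓞 K, v 0 * w 1 - v 1 * w 0 ≠ 0 ∧
      (∀ σ i, |latticeVec g v σ i| ≤ R) ∧ ∀ σ i, |latticeVec g w σ i| ≤ R := by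
  obtain ⟨C, hC, hshort⟩ := exists_short_vector K
  -- The stretch factor `s = 2C/ε` makes `C / s = ε / 2`.
  have hs : 0 < 2 * C / ε := by positivity
  refine ⟨max C (C / (2 * C / ε) + C * (2 * C / ε)), fun g hg => ?_⟩
  obtain ⟨v, hv0, hv⟩ := hshort g
  choose h hh using fun σ => exists_stretch (latticeVec g v σ) (latticeVec_ne_zero g hv0 σ) hs
  obtain ⟨w, hw0, hw⟩ := hshort (h * g)
  have hw' : ∀ σ i, |((h σ).1 *ᵥ latticeVec g w σ) i| ≤ C := fun σ i => by
    rw [← latticeVec_mul (g := g) (h := h)]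
    exact hw σ i
  refine ⟨v, w, fun hdet => ?_, fun σ i => (hv σ i).trans (le_max_left _ _),
    fun σ i => ((hh σ _ C (hw' σ)).1 i).trans (le_max_right _ _)⟩
  obtain ⟨σ, i, hi⟩ := hg w hw0
  -- With zero determinant, `w` is parallel to `v` in every factor, so undoing the stretch shrinks
  -- it below the systole.
  have hle := (hh σ _ C (hw' σ)).2 (by rw [latticeVec_det, hdet]; simp) i
  have : C / (2 * C / ε) = ε / 2 := by field_simp
  linarith

end

/-- Two matrices over a domain with the same nonzero determinant `δ` that are congruent modulo `δ`
differ by left multiplication by a matrix of determinant one. -/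
theorem exists_specialLinear_mul_eq {A : Type*} [CommRing A] [IsDomain A]
    {V W : Matrix (Fin 2) (Fin 2) A} (h0 : W.det ≠ 0) (hdet : V.det = W.det)
    (hmod : ∀ i j, W.det ∣ V i j - W i j) :
    ∃ γ : SpecialLinearGroup (Fin 2) A, V = γ.1 * W := by
  choose T hT using hmod
  have hV : V = W + W.det • Matrix.of T := by
    ext i j
    simp [← hT]
  have hγ : W.det • (1 + Matrix.of T * W.adjugate) = V * W.adjugate := by
    rw [hV, add_mul, Matrix.mul_adjugate, smul_add, Matrix.smul_mul]
  -- This matrix is `V W⁻¹`: as `W⁻¹ = adj W / det W`, the congruence cancels the denominator.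
  have hmul : (1 + Matrix.of T * W.adjugate) * W = V := by
    rw [add_mul, mul_assoc, Matrix.adjugate_mul, hV]
    simp
  refine ⟨⟨1 + Matrix.of T * W.adjugate, ?_⟩, hmul.symm⟩
  have := congrArg Matrix.det hmul
  rw [Matrix.det_mul, hdet] at this
  exact mul_right_cancel₀ h0 (this.trans (one_mul _).symm)

theorem mul_thetaSL_apply (g : G K) (γ : SpecialLinearGroup (Fin 2) (𝓞 K)) (σ : K →+* ℝ) :
    ((g * thetaSL K γ) σ).1 = (g σ).1 * γ.1.map (σ.comp (algebraMap (𝓞 K) K)) := rfl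

/-- Fix one `W` in the class. Then `V = γW`, and `gγ = (gV) adj(W) / δ` is bounded in terms of `R`
and `W` alone. -/
theorem exists_bound_of_congruence_class [NumberField K] {δ : 𝓞 K} (h0 : δ ≠ 0)
    (c : Fin 2 → Fin 2 → 𝓞 K ⧸ Ideal.span {δ}) (R : ℝ) :
    ∃ M : ℝ, ∀ (g : G K) (V : Matrix (Fin 2) (Fin 2) (𝓞 K)), V.det = δ →
      (∀ i j, Ideal.Quotient.mk _ (V i j) = c i j) →
      (∀ σ i j, |((g σ).1 * V.map (σ.comp (algebraMap (𝓞 K) K))) i j| ≤ R) →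
      ∃ γ, ∀ σ i j, |((g * thetaSL K γ) σ).1 i j| ≤ M := by
  by_cases hW : ∃ W : Matrix (Fin 2) (Fin 2) (𝓞 K), W.det = δ ∧
      ∀ i j, Ideal.Quotient.mk _ (W i j) = c i j
  swap
  · exact ⟨0, fun g V hV hc _ => absurd ⟨V, hV, hc⟩ hW⟩
  obtain ⟨W, rfl, hWc⟩ := hW
  obtain ⟨M, hM⟩ := Finite.exists_le fun k : (K →+* ℝ) × Fin 2 =>
    (R * |k.1 (W.adjugate 0 k.2 : K)| + R * |k.1 (W.adjugate 1 k.2 : K)|) / |k.1 (W.det : K)|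
  refine ⟨M, fun g V hV hc hR => ?_⟩
  obtain ⟨γ, hγ⟩ := exists_specialLinear_mul_eq h0 hV fun i j => by
    rw [← Ideal.mem_span_singleton, ← Ideal.Quotient.eq, hc, hWc]
  refine ⟨γ, fun σ i j => le_trans ?_ (hM (σ, j))⟩
  have hσ : 0 < |σ (W.det : K)| := by simpa using h0
  rw [le_div_iff₀ hσ, ← abs_mul]
  have key : ((g * thetaSL K γ) σ).1 i j * σ (W.det : K) =
      ((g σ).1 * V.map (σ.comp (algebraMap (𝓞 K) K))) i 0 * σ (W.adjugate 0 j : K) +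
      ((g σ).1 * V.map (σ.comp (algebraMap (𝓞 K) K))) i 1 * σ (W.adjugate 1 j : K) := by
    have h1 : ((g σ).1 * V.map (σ.comp (algebraMap (𝓞 K) K))) *
        W.adjugate.map (σ.comp (algebraMap (𝓞 K) K)) =
        σ (W.det : K) • ((g * thetaSL K γ) σ).1 := by
      rw [mul_thetaSL_apply, mul_assoc, ← Matrix.map_mul, hγ, mul_assoc, Matrix.mul_adjugate,
        ← Matrix.mul_smul]
      congr 1
      ext a b
      simp
    have h2 := congrFun (congrFun h1 i) j
    rw [Matrix.mul_apply, Fin.sum_univ_two] at h2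
    rw [mul_comm]
    exact h2.symm
  rw [key]
  refine (abs_add_le _ _).trans ?_
  rw [abs_mul, abs_mul]
  gcongr
  · exact hR σ i 0
  · exact hR σ i 1

variable [NumberField K] [NumberField.IsTotallyReal K]

/-- The nontrivial part of Mahler's compactness criterion for `G/Γ`: elements of `G` with bounded
below systole have bounded representatives modulo `Γ`. -/
theorem exists_bounded_representative {ε : ℝ} (hε : 0 < ε) :
    ∃ M : ℝ, ∀ g ∈ systoleSet K ε, ∃ γ, ∀ σ i j, |((g * thetaSL K γ) σ).1 i j| ≤ M := by
  obtain ⟨R, hR⟩ := exists_independent_short_vectors (K := K) hε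
  have hδ : ∀ δ : 𝓞 K, ∃ M : ℝ, δ ≠ 0 → ∀ (g : G K) (V : Matrix (Fin 2) (Fin 2) (𝓞 K)),
      V.det = δ → (∀ σ i j, |((g σ).1 * V.map (σ.comp (algebraMap (𝓞 K) K))) i j| ≤ R) →
      ∃ γ, ∀ σ i j, |((g * thetaSL K γ) σ).1 i j| ≤ M := by
    intro δ
    by_cases h0 : δ = 0
    · exact ⟨0, fun h => absurd h0 h⟩
    have : Finite (𝓞 K ⧸ Ideal.span {δ}) :=
      Ring.HasFiniteQuotients.finiteQuotient (by simpa using h0)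
    choose M hM using fun c => exists_bound_of_congruence_class h0 c R
    obtain ⟨B, hB⟩ := Finite.exists_le M
    refine ⟨B, fun _ g V hV hVR => ?_⟩
    obtain ⟨γ, hγ⟩ := hM (fun i j => Ideal.Quotient.mk _ (V i j)) g V hV (fun _ _ => rfl) hVR
    exact ⟨γ, fun σ i j => (hγ σ i j).trans (hB _)⟩
  choose M hM using hδ
  have := (finite_abs_le (K := K) (2 * R ^ 2)).to_subtype
  obtain ⟨B, hB⟩ := Finite.exists_le
    fun δ : {a : 𝓞 K | ∀ σ : K →+* ℝ, |σ (a : K)| ≤ 2 * R ^ 2} => M δ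
  refine ⟨B, fun g hg => ?_⟩
  obtain ⟨v, w, hdet, hv, hw⟩ := hR g hg
  have hmem : v 0 * w 1 - v 1 * w 0 ∈ {a : 𝓞 K | ∀ σ : K →+* ℝ, |σ (a : K)| ≤ 2 * R ^ 2} := by
    intro σ
    rw [← latticeVec_det g]
    have hR0 : 0 ≤ R := (abs_nonneg _).trans (hv σ 0)
    have h1 := mul_le_mul (hv σ 0) (hw σ 1) (abs_nonneg _) hR0
    have h2 := mul_le_mul (hv σ 1) (hw σ 0) (abs_nonneg _) hR0
    rw [← abs_mul] at h1 h2
    have h3 := abs_sub (latticeVec g v σ 0 * latticeVec g w σ 1)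
      (latticeVec g v σ 1 * latticeVec g w σ 0)
    linarith
  obtain ⟨γ, hγ⟩ := hM _ hdet g !![v 0, w 0; v 1, w 1] (by rw [Matrix.det_fin_two_of]; ring) (by
    intro σ i j
    fin_cases j
    · convert hv σ i using 2
      simp [Matrix.mul_apply, latticeVec_apply, Fin.sum_univ_two]
    · convert hw σ i using 2
      simp [Matrix.mul_apply, latticeVec_apply, Fin.sum_univ_two])
  exact ⟨γ, fun σ i j => (hγ σ i j).trans (hB ⟨_, hmem⟩)⟩

end Mahler

/-! ### Mahler's compactness criterion. -/

section Compactness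

variable {K : Type*} [Field K]

theorem continuous_entry (σ : K →+* ℝ) (i j : Fin 2) :
    Continuous fun g : G K => (g σ).1 i j :=
  (continuous_subtype_val.comp (continuous_apply σ)).matrix_elem i j

theorem latticeVec_mul_thetaSL (g : G K) (γ : SpecialLinearGroup (Fin 2) (𝓞 K))
    (v : Fin 2 → 𝓞 K) : latticeVec (g * thetaSL K γ) v = latticeVec g (γ.1 *ᵥ v) := by
  funext σ
  rw [latticeVec_mul]
  simp only [latticeVec]
  refine congrArg ((g σ).1 *ᵥ ·) (funext fun i => ?_)
  exact (RingHom.map_mulVec (σ.comp (algebraMap (𝓞 K) K)) γ.1 v i).symm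

theorem mul_thetaSL_mem_systoleSet {ε : ℝ} {g : G K} (hg : g ∈ systoleSet K ε)
    (γ : SpecialLinearGroup (Fin 2) (𝓞 K)) : g * thetaSL K γ ∈ systoleSet K ε := by
  intro v hv
  rw [latticeVec_mul_thetaSL]
  refine hg _ fun h => hv (Matrix.eq_zero_of_mulVec_eq_zero ?_ h)
  rw [γ.2]
  exact one_ne_zero

/-- The systole sets are invariant under `Γ`. -/
theorem proj_preimage_image_systoleSet (ε : ℝ) :
    proj ⁻¹' (proj '' systoleSet K ε) = systoleSet K ε := by
  refine Set.Subset.antisymm ?_ (Set.subset_preimage_image _ _)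
  rintro g ⟨h, hh, heq⟩
  obtain ⟨γ, hγ⟩ := QuotientGroup.eq.1 heq
  have : g = h * thetaSL K γ := by rw [hγ]; group
  rw [this]
  exact mul_thetaSL_mem_systoleSet hh γ

theorem isCompact_entries_le (M : ℝ) : IsCompact {g : G K | ∀ σ i j, |(g σ).1 i j| ≤ M} := by
  have h1 : IsCompact {A : SpecialLinearGroup (Fin 2) ℝ | ∀ i j, |A.1 i j| ≤ M} := by
    have h2 : IsCompact (Set.univ.pi fun _ => Set.univ.pi fun _ => Set.Icc (-M) M :
        Set (Fin 2 → Fin 2 → ℝ)) :=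
      isCompact_univ_pi fun _ => isCompact_univ_pi fun _ => isCompact_Icc
    have h3 : {A : SpecialLinearGroup (Fin 2) ℝ | ∀ i j, |A.1 i j| ≤ M} = Subtype.val ⁻¹'
        (Set.univ.pi fun _ => Set.univ.pi fun _ => Set.Icc (-M) M :
          Set (Fin 2 → Fin 2 → ℝ)) :=
      Set.ext fun A => ⟨fun h i _ j _ => abs_le.1 (h i j),
        fun h i j => abs_le.2 (h i trivial j trivial)⟩
    rw [h3]
    exact Matrix.SpecialLinearGroup.isClosedEmbedding_val.isCompact_preimage h2
  have h4 : {g : G K | ∀ σ i j, |(g σ).1 i j| ≤ M} = Set.univ.pi fun _ : K →+* ℝ =>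
      {A : SpecialLinearGroup (Fin 2) ℝ | ∀ i j, |A.1 i j| ≤ M} :=
    Set.ext fun g => by simp [Set.mem_pi]
  rw [h4]
  exact isCompact_univ_pi fun _ => h1

theorem systoleSet_mono {ε δ : ℝ} (h : ε ≤ δ) : systoleSet K δ ⊆ systoleSet K ε := by
  intro g hg v hv
  obtain ⟨σ, i, hi⟩ := hg v hv
  exact ⟨σ, i, h.trans hi⟩

variable [NumberField K]

theorem isClosed_systoleSet (ε : ℝ) : IsClosed (systoleSet K ε) := by
  have : systoleSet K ε = ⋂ v : Fin 2 → 𝓞 K, ⋂ _ : v ≠ 0, ⋃ σ : K →+* ℝ, ⋃ i : Fin 2,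
      {g | ε ≤ |latticeVec g v σ i|} := by
    ext g
    simp [systoleSet]
  rw [this]
  refine isClosed_iInter fun v => isClosed_iInter fun _ => isClosed_iUnion_of_finite fun σ =>
    isClosed_iUnion_of_finite fun i => isClosed_le continuous_const ?_
  simp only [latticeVec_apply]
  exact (((continuous_entry σ i 0).mul continuous_const).add
    ((continuous_entry σ i 1).mul continuous_const)).abs

theorem isClosed_image_systoleSet (ε : ℝ) : IsClosed (proj '' systoleSet K ε) := by
  have h : IsClosed (proj ⁻¹' (proj '' systoleSet K ε)) := by
    rw [proj_preimage_image_systoleSet]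
    exact isClosed_systoleSet ε
  exact (isQuotientMap_quot_mk (X := G K)).isClosed_preimage.1 h

variable [NumberField.IsTotallyReal K]

theorem isCompact_image_systoleSet {ε : ℝ} (hε : 0 < ε) :
    IsCompact (proj '' systoleSet K ε) := by
  obtain ⟨M, hM⟩ := exists_bounded_representative (K := K) hε
  refine ((isCompact_entries_le M).image QuotientGroup.continuous_mk).of_isClosed_subset
    (isClosed_image_systoleSet ε) ?_
  rintro _ ⟨g, hg, rfl⟩
  obtain ⟨γ, hγ⟩ := hM g hg
  exact ⟨_, hγ, (QuotientGroup.eq.2 (show g⁻¹ * (g * thetaSL K γ) ∈ Gam K from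
    ⟨γ, by group⟩)).symm⟩

/-- Some coordinate of `v` has a conjugate of absolute value at least `1`. Inverting `g σ` by its
adjugate recovers it from `g v`; with both coordinates of `g v` below `1 / (2M)` it would be less
than `2 · M · 1 / (2M) = 1`. -/
theorem mem_systoleSet_of_entries_lt {g : G K} {M : ℝ} (hM : 0 < M)
    (h : ∀ σ i j, |(g σ).1 i j| < M) : g ∈ systoleSet K (1 / (2 * M)) := by
  intro v hv
  obtain ⟨j, hj⟩ := Function.ne_iff.1 hv
  obtain ⟨σ, hσ⟩ := exists_one_le_abs (K := K) hj
  refine ⟨σ, ?_⟩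
  by_contra! hlt
  have hdet := (g σ).2
  rw [Matrix.det_fin_two] at hdet
  have key : ∀ a b p q : ℝ, |a| < M → |b| < M → |p| < 1 / (2 * M) → |q| < 1 / (2 * M) →
      |a * p - b * q| < 1 := by
    intro a b p q ha hb hp hq
    have h1 := mul_lt_mul'' ha hp (abs_nonneg _) (abs_nonneg _)
    have h2 := mul_lt_mul'' hb hq (abs_nonneg _) (abs_nonneg _)
    rw [← abs_mul] at h1 h2
    have h3 : M * (1 / (2 * M)) = 1 / 2 := by field_simp
    linarith [abs_sub (a * p) (b * q)]
  have h0 := latticeVec_apply g v σ 0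
  have h1 := latticeVec_apply g v σ 1
  have e0 : σ (v 0 : K) = (g σ).1 1 1 * latticeVec g v σ 0 - (g σ).1 0 1 * latticeVec g v σ 1 := by
    rw [h0, h1]; linear_combination (-σ (v 0 : K)) * hdet
  have e1 : σ (v 1 : K) = (g σ).1 0 0 * latticeVec g v σ 1 - (g σ).1 1 0 * latticeVec g v σ 0 := by
    rw [h0, h1]; linear_combination (-σ (v 1 : K)) * hdet
  fin_cases j
  · refine absurd hσ (not_le.2 ?_)
    simpa [e0] using key _ _ _ _ (h σ 1 1) (h σ 0 1) (hlt 0) (hlt 1)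
  · refine absurd hσ (not_le.2 ?_)
    simpa [e1] using key _ _ _ _ (h σ 0 0) (h σ 1 0) (hlt 1) (hlt 0)

/-- **Mahler's compactness criterion** for `G/Γ`. -/
theorem isBoundedSet_iff_exists_systole (A : Set (G K ⧸ Gam K)) :
    IsBoundedSet A ↔ ∃ ε > 0, A ⊆ proj '' systoleSet K ε := by
  constructor
  · intro hA
    -- The images of these increasing open sets cover the quotient, so one of them contains the
    -- compact closure.
    let U : ℕ → Set (G K) := fun n => {g | ∀ σ i j, |(g σ).1 i j| < (n + 1 : ℝ)}
    have hU : ∀ n, IsOpen (U n) := by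
      intro n
      simp only [U, Set.ofPred_forall]
      exact isOpen_iInter_of_finite fun σ => isOpen_iInter_of_finite fun i =>
        isOpen_iInter_of_finite fun j =>
          isOpen_lt (continuous_entry σ i j).abs continuous_const
    have hmono : Monotone U := fun m n hmn g hg σ i j =>
      (hg σ i j).trans_le (by gcongr)
    obtain ⟨n, hn⟩ := hA.elim_directed_cover (fun n => proj '' U n)
      (fun n => QuotientGroup.isOpenMap_coe _ (hU n)) (by
        intro y _
        obtain ⟨g, rfl⟩ := QuotientGroup.mk_surjective y
        obtain ⟨M, hM⟩ := Finite.exists_le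
          fun k : (K →+* ℝ) × Fin 2 × Fin 2 => |(g k.1).1 k.2.1 k.2.2|
        obtain ⟨n, hn⟩ := exists_nat_gt M
        refine Set.mem_iUnion.2 ⟨n, g, fun σ i j => ?_, rfl⟩
        exact (hM (σ, i, j)).trans_lt (by linarith))
      (directed_of_isDirected_le fun m n h => Set.image_mono (hmono h))
    refine ⟨1 / (2 * (n + 1)), by positivity, subset_closure.trans (hn.trans ?_)⟩
    exact Set.image_mono fun g hg => mem_systoleSet_of_entries_lt (by positivity) hg
  · rintro ⟨ε, hε, hA⟩
    exact (isCompact_image_systoleSet hε).of_isClosed_subset isClosed_closure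
      (closure_minimal hA (isClosed_image_systoleSet ε))

theorem isBoundedSet_trajectory_iff (r : RealSpace K) (g : G K) :
    IsBoundedSet (trajectory (semiflow r) (proj g)) ↔
      ∃ ε > 0, ∀ t, 0 ≤ t → flow r t * g ∈ systoleSet K ε := by
  rw [isBoundedSet_iff_exists_systole]
  refine exists_congr fun ε => and_congr_right fun _ => ?_
  constructor
  · intro h t ht
    rw [← proj_preimage_image_systoleSet]
    exact h ⟨flow r t, ⟨t, ht, rfl⟩, rfl⟩
  · rintro h _ ⟨_, ⟨t, ht, rfl⟩, rfl⟩
    exact ⟨_, h t ht, rfl⟩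

end Compactness

/-! ### Short vectors and good approximations. -/

section Approximation

variable {K : Type*} [Field K]

theorem approxSize_nonneg (r x : RealSpace K) (p q : 𝓞 K) : 0 ≤ approxSize r x p q :=
  le_max_of_le_right (Real.iSup_nonneg fun _ => le_max_of_le_left (abs_nonneg _))

theorem rNorm_nonneg (r x : RealSpace K) : 0 ≤ rNorm r x :=
  Real.iSup_nonneg fun _ => Real.rpow_nonneg (abs_nonneg _) _

theorem isBadlyApproximable_iff (r x : RealSpace K) :
    IsBadlyApproximable r x ↔ ∃ c > 0, ∀ p q : 𝓞 K, q ≠ 0 → c ≤ approxSize r x p q := by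
  constructor
  · intro h
    refine ⟨_, h, fun p q hq => ?_⟩
    exact ciInf_le ⟨0, by rintro _ ⟨_, rfl⟩; exact approxSize_nonneg _ _ _ _⟩
      (⟨p, q, hq⟩ : 𝓞 K × {q : 𝓞 K // q ≠ 0})
  · rintro ⟨c, hc, h⟩
    have : Nonempty {q : 𝓞 K // q ≠ 0} := ⟨⟨1, one_ne_zero⟩⟩
    exact hc.trans_le (le_ciInf fun pq => h _ _ pq.2.2)

theorem latticeVec_flow_unip_zero (r x : RealSpace K) (t : ℝ) (v : Fin 2 → 𝓞 K) (σ : K →+* ℝ) :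
    latticeVec (flow r t * unip x) v σ 0 =
      Real.exp (r σ * t) * (σ (v 1 : K) * x σ + σ (v 0 : K)) := by
  rw [latticeVec_mul]
  simp only [flow, unip, latticeVec, Matrix.mulVec, dotProduct, Fin.sum_univ_two,
    Matrix.of_apply, Matrix.cons_val_zero, Matrix.cons_val_one]
  ring

theorem latticeVec_flow_unip_one (r x : RealSpace K) (t : ℝ) (v : Fin 2 → 𝓞 K) (σ : K →+* ℝ) :
    latticeVec (flow r t * unip x) v σ 1 = Real.exp (-(r σ * t)) * σ (v 1 : K) := by
  rw [latticeVec_mul]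
  simp only [flow, unip, latticeVec, Matrix.mulVec, dotProduct, Fin.sum_univ_two,
    Matrix.of_apply, Matrix.cons_val_zero, Matrix.cons_val_one]
  ring

theorem abs_le_of_abs_exp_mul_lt {a z ε : ℝ} (h : |Real.exp a * z| < ε) :
    |z| ≤ ε * Real.exp (-a) := by
  rw [abs_mul, abs_of_pos (Real.exp_pos a)] at h
  rw [Real.exp_neg, ← div_eq_mul_inv, le_div_iff₀ (Real.exp_pos a), mul_comm]
  exact h.le

/-- A short vector of `g_r(t) u(x) 𝒪_K²` gives a good approximation of `x`. -/
theorem approxSize_le_of_short {r x : RealSpace K} (hr : ∀ σ, 0 ≤ r σ)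
    {ε : ℝ} (hε : 0 < ε) (hε1 : ε ≤ 1) {t : ℝ} {v : Fin 2 → 𝓞 K}
    (h : ∀ σ i, |latticeVec (flow r t * unip x) v σ i| < ε) :
    approxSize r x (v 0) (v 1) ≤ ε := by
  have h0 : ∀ σ : K →+* ℝ, |σ (v 1 : K) * x σ + σ (v 0 : K)| ≤ ε * Real.exp (-(r σ * t)) :=
    fun σ => abs_le_of_abs_exp_mul_lt (by rw [← latticeVec_flow_unip_zero]; exact h σ 0)
  have h1 : ∀ σ : K →+* ℝ, |σ (v 1 : K)| ≤ ε * Real.exp (r σ * t) := fun σ => by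
    have := abs_le_of_abs_exp_mul_lt (a := -(r σ * t)) (z := σ (v 1 : K)) (ε := ε)
      (by rw [← latticeVec_flow_unip_one (x := x)]; exact h σ 1)
    rwa [neg_neg] at this
  have hN : rNorm r (theta (v 1 : K)) ≤ Real.exp t := by
    refine Real.iSup_le (fun ⟨σ, hσ⟩ => ?_) (Real.exp_pos t).le
    have hle : |σ (v 1 : K)| ≤ Real.exp (r σ * t) :=
      (h1 σ).trans (mul_le_of_le_one_left (Real.exp_pos _).le hε1)
    refine (Real.rpow_le_rpow (abs_nonneg _) hle (by positivity)).trans_eq ?_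
    rw [← Real.exp_mul]
    congr 1
    field_simp
  refine max_le (Real.iSup_le (fun ⟨σ, hσ⟩ => ?_) hε.le)
    (Real.iSup_le (fun ⟨σ, hσ⟩ => ?_) hε.le)
  · have hN' := Real.rpow_le_rpow (rNorm_nonneg _ _) hN hσ.le
    rw [← Real.exp_mul] at hN'
    refine (mul_le_mul hN' (h0 σ) (abs_nonneg _) (Real.exp_pos _).le).trans_eq ?_
    rw [mul_comm ε, ← mul_assoc, ← Real.exp_add]
    simp [mul_comm t]
  · have hσ0 : r σ = 0 := le_antisymm (not_lt.1 hσ) (hr σ)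
    have h0' := h0 σ
    have h1' := h1 σ
    simp only [hσ0, zero_mul, neg_zero, Real.exp_zero, mul_one] at h0' h1'
    exact max_le h0' h1'

variable [NumberField K]

theorem le_approxSize_of_pos (r x : RealSpace K) (p q : 𝓞 K) {σ : K →+* ℝ} (hσ : 0 < r σ) :
    rNorm r (theta (q : K)) ^ r σ * |σ (q : K) * x σ + σ (p : K)| ≤ approxSize r x p q :=
  le_max_of_le_left (le_ciSup (f := fun σ : {σ : K →+* ℝ // 0 < r σ} =>
    rNorm r (theta (q : K)) ^ r σ * |σ.1 (q : K) * x σ + σ.1 (p : K)|)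
      (Set.finite_range _).bddAbove ⟨σ, hσ⟩)

theorem le_approxSize_of_not_pos (r x : RealSpace K) (p q : 𝓞 K) {σ : K →+* ℝ}
    (hσ : ¬ 0 < r σ) :
    max |σ (q : K) * x σ + σ (p : K)| |σ (q : K)| ≤ approxSize r x p q :=
  le_max_of_le_right (le_ciSup (f := fun σ : {σ : K →+* ℝ // ¬ 0 < r σ} =>
    max |σ.1 (q : K) * x σ + σ.1 (p : K)| |σ.1 (q : K)|)
      (Set.finite_range _).bddAbove ⟨σ, hσ⟩)

theorem abs_le_rNorm_rpow (r y : RealSpace K) {σ : K →+* ℝ} (hσ : 0 < r σ) :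
    |y σ| ≤ rNorm r y ^ r σ := by
  have h : |y σ| ^ (1 / r σ) ≤ rNorm r y :=
    le_ciSup (f := fun σ : {σ : K →+* ℝ // 0 < r σ} => |y σ| ^ (1 / r σ))
      (Set.finite_range _).bddAbove ⟨σ, hσ⟩
  have h2 := Real.rpow_le_rpow (by positivity) h hσ.le
  rwa [← Real.rpow_mul (abs_nonneg _), one_div_mul_cancel hσ.ne', Real.rpow_one] at h2

variable [NumberField.IsTotallyReal K]

theorem exists_systole_of_approxSize {r x : RealSpace K} (hr : ∀ σ, 0 ≤ r σ)
    {c : ℝ} (hc : 0 < c)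
    (h : ∀ p q : 𝓞 K, q ≠ 0 → c ≤ approxSize r x p q) :
    ∃ ε > 0, ∀ t, 0 ≤ t → flow r t * unip x ∈ systoleSet K ε := by
  -- The bound `c / 2` contradicts `c ≤ approxSize` strictly; the bound `1` rules out vectors with
  -- `q = 0`, whose first coordinates do not contract.
  have hε : 0 < min (c / 2) 1 := by positivity
  refine ⟨min (c / 2) 1, hε, fun t ht v hv => ?_⟩
  by_contra! hlt
  by_cases hq : v 1 = 0
  · have hp : v 0 ≠ 0 := fun hp => hv (funext fun i => by fin_cases i <;> assumption)
    obtain ⟨σ, hσ⟩ := exists_one_le_abs (K := K) hp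
    have h0 := (hlt σ 0).trans_le (min_le_right _ _)
    have hexp : 1 ≤ Real.exp (r σ * t) := Real.one_le_exp (mul_nonneg (hr σ) ht)
    rw [latticeVec_flow_unip_zero, hq, abs_mul, abs_of_pos (Real.exp_pos _)] at h0
    simp only [map_zero, zero_mul, zero_add] at h0
    nlinarith
  · have := (h (v 0) (v 1) hq).trans
      (approxSize_le_of_short hr hε (min_le_right _ _) hlt)
    linarith [min_le_left (c / 2) 1]

theorem exists_approxSize_of_systole {r x : RealSpace K} (hr : ∀ σ, 0 ≤ r σ)
    (hr1 : ∀ σ, r σ ≤ 1) {ε : ℝ} (hε : 0 < ε)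
    (h : ∀ t, 0 ≤ t → flow r t * unip x ∈ systoleSet K ε) :
    ∃ c > 0, ∀ p q : 𝓞 K, q ≠ 0 → c ≤ approxSize r x p q := by
  wlog hε1 : ε ≤ 1 generalizing ε
  · exact this one_pos (fun t ht => systoleSet_mono (not_le.1 hε1).le (h t ht)) le_rfl
  -- `A` is chosen so that `A ^ r σ > 1 / ε` for every `σ ∈ S₁`.
  obtain ⟨B, hB⟩ := Finite.exists_le fun σ : {σ : K →+* ℝ // 0 < r σ} => ε⁻¹ ^ (1 / r σ)
  obtain ⟨A, hA1, hAB⟩ : ∃ A : ℝ, 1 ≤ A ∧ B < A :=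
    ⟨max 1 (B + 1), le_max_left _ _, (lt_add_one B).trans_le (le_max_right _ _)⟩
  have hA0 : 0 < A := one_pos.trans_le hA1
  have hA : ∀ σ : K →+* ℝ, 0 < r σ → ε⁻¹ < A ^ r σ := fun σ hσ => by
    have h2 := Real.rpow_lt_rpow (by positivity) ((hB ⟨σ, hσ⟩).trans_lt hAB) hσ
    rwa [← Real.rpow_mul (by positivity), one_div_mul_cancel hσ.ne', Real.rpow_one] at h2
  have hcε : ε / A ≤ ε := div_le_self hε.le hA1
  refine ⟨ε / A, by positivity, fun p q hq => ?_⟩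
  have hN0 : 0 ≤ rNorm r (theta (q : K)) := rNorm_nonneg _ _
  -- Below `1` the time `log (A‖q‖_r)` is unavailable, being negative or undefined. Then all
  -- conjugates of `q` over `S₁` are less than `1` in absolute value, so one over `S₂` is at least
  -- `1`.
  rcases lt_or_ge (rNorm r (theta (q : K)) * A) 1 with hlt | hge
  · obtain ⟨σ, hσ⟩ := exists_one_le_abs (K := K) hq
    by_cases hpos : 0 < r σ
    · have hN1 : rNorm r (theta (q : K)) < 1 := by nlinarith
      exact absurd (hσ.trans (abs_le_rNorm_rpow r (theta (q : K)) hpos))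
        (not_le.2 (Real.rpow_lt_one hN0 hN1 hpos))
    · exact (hcε.trans hε1).trans
        (hσ.trans ((le_max_right _ _).trans (le_approxSize_of_not_pos r x p q hpos)))
  · have hNA : 0 < rNorm r (theta (q : K)) * A := one_pos.trans_le hge
    have hexp : ∀ σ : K →+* ℝ, Real.exp (r σ * Real.log (rNorm r (theta (q : K)) * A)) =
        rNorm r (theta (q : K)) ^ r σ * A ^ r σ := fun σ => by
      rw [← Real.mul_rpow hN0 hA0.le, Real.rpow_def_of_pos hNA, mul_comm]
    obtain ⟨σ, i, hi⟩ := h _ (Real.log_nonneg hge) ![p, q] (fun h0 => hq (congrFun h0 1))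
    by_cases hpos : 0 < r σ
    · have hAσ : 0 < A ^ r σ := by positivity
      revert hi
      fin_cases i
      · intro hi
        refine le_trans ?_ (le_approxSize_of_pos r x p q hpos)
        have hi' := hi.trans_eq (congrArg _ (latticeVec_flow_unip_zero _ _ _ _ _))
        rw [abs_mul, abs_of_pos (Real.exp_pos _), hexp] at hi'
        simp only [Matrix.cons_val_zero, Matrix.cons_val_one] at hi'
        have hAle : A ^ r σ ≤ A := by
          simpa using Real.rpow_le_rpow_of_exponent_le hA1 (hr1 σ)
        rw [div_le_iff₀ hA0]
        refine hi'.trans ?_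
        rw [mul_right_comm]
        gcongr
      -- This coordinate is at most `A ^ (-r σ) < ε` at the chosen time, so it cannot be the large
      -- one.
      · intro hi
        have hi' := hi.trans_eq (congrArg _ (latticeVec_flow_unip_one _ _ _ _ _))
        rw [abs_mul, abs_of_pos (Real.exp_pos _), Real.exp_neg, hexp] at hi'
        simp only [Matrix.cons_val_one] at hi'
        have hq' : |σ (q : K)| ≤ _ := abs_le_rNorm_rpow r (theta (q : K)) hpos
        have hNpos : 0 < rNorm r (theta (q : K)) ^ r σ :=
          Real.rpow_pos_of_pos (pos_of_mul_pos_left hNA hA0.le) _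
        have hle : ε ≤ (A ^ r σ)⁻¹ := by
          refine hi'.trans ((mul_le_mul_of_nonneg_left hq' (by positivity)).trans_eq ?_)
          field_simp
        exact absurd hle (not_le.2 (inv_lt_of_inv_lt₀ hε (hA σ hpos)))
    · have hσ0 : r σ = 0 := le_antisymm (not_lt.1 hpos) (hr σ)
      refine hcε.trans (le_trans ?_ (le_approxSize_of_not_pos r x p q hpos))
      revert hi
      fin_cases i
      · intro hi
        have hi' := hi.trans_eq (congrArg _ (latticeVec_flow_unip_zero _ _ _ _ _))
        rw [hσ0, zero_mul, Real.exp_zero, one_mul] at hi'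
        exact hi'.trans (le_max_left _ _)
      · intro hi
        have hi' := hi.trans_eq (congrArg _ (latticeVec_flow_unip_one _ _ _ _ _))
        rw [hσ0, zero_mul, neg_zero, Real.exp_zero, one_mul] at hi'
        exact hi'.trans (le_max_right _ _)

/-- The Dani correspondence. -/
theorem isBadlyApproximable_iff_isBoundedSet {r : RealSpace K} (hr : ∀ σ, 0 ≤ r σ)
    (hr1 : ∀ σ, r σ ≤ 1) (x : RealSpace K) :
    IsBadlyApproximable r x ↔ IsBoundedSet (trajectory (semiflow r) (proj (unip x))) := by
  rw [isBadlyApproximable_iff, isBoundedSet_trajectory_iff]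
  constructor
  · rintro ⟨c, hc, h⟩
    exact exists_systole_of_approxSize hr hc h
  · rintro ⟨ε, hε, h⟩
    exact exists_approxSize_of_systole hr hr1 hε h

end Approximation

/-! ### The expanding horospherical subgroup. -/

section Horospherical

variable {K : Type*} [Field K]

theorem continuous_unip : Continuous (unip : RealSpace K → G K) := by
  refine continuous_pi fun σ => Continuous.subtype_mk (continuous_matrix fun i j => ?_) _
  fin_cases i <;> fin_cases j <;> simp <;> fun_prop

theorem unip_zero : unip (0 : RealSpace K) = 1 := by
  funext σ
  apply Subtype.ext
  simp [unip, Matrix.one_fin_two]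

theorem flow_inv_mul_unip_mul_flow (r x : RealSpace K) (t : ℝ) :
    (flow r t)⁻¹ * unip x * flow r t = unip fun σ => Real.exp (-(2 * r σ) * t) * x σ := by
  rw [mul_assoc, inv_mul_eq_iff_eq_mul]
  funext σ
  apply Subtype.ext
  have h : Real.exp (r σ * t) * (Real.exp (-(2 * r σ * t)) * x σ) =
      x σ * Real.exp (-(r σ * t)) := by
    rw [← mul_assoc, ← Real.exp_add, mul_comm]
    congr 2
    ring
  simp only [Pi.mul_apply, Matrix.SpecialLinearGroup.coe_mul]
  simpa [unip, flow] using h.symm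

/-- Every weight must be positive: a coordinate with `r σ = 0` is fixed by the conjugation. -/
theorem unip_mem_horospherical {r : RealSpace K} (hr : ∀ σ, 0 < r σ) (x : RealSpace K) :
    unip x ∈ horospherical r := by
  simp only [horospherical, Set.mem_ofPred_eq, flow_inv_mul_unip_mul_flow, ← unip_zero]
  refine (continuous_unip.tendsto 0).comp (tendsto_pi_nhds.2 fun σ => ?_)
  have h : Tendsto (fun t : ℝ => -(2 * r σ) * t) atTop atBot :=
    tendsto_id.const_mul_atTop_of_neg (by linarith [hr σ])
  simpa using (Real.tendsto_exp_atBot.comp h).mul_const (x σ)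

end Horospherical

end DaniCorrespondence

end

/-- Dani correspondence for a totally real field `K` and a weight vector `r`. -/
theorem proposition3p4 (K : Type*) [Field K] [NumberField K] [NumberField.IsTotallyReal K]
    (r : DaniCorrespondence.RealSpace K) (hr : ∀ σ, 0 ≤ r σ) (hsum : ∑ σ, r σ = 1) :
    (∀ x : DaniCorrespondence.RealSpace K,
      DaniCorrespondence.IsBadlyApproximable r x ↔
        DaniCorrespondence.IsBoundedSet
          (DaniCorrespondence.trajectory (DaniCorrespondence.semiflow r)
            (DaniCorrespondence.proj (DaniCorrespondence.unip x)))) ∧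
    DaniCorrespondence.Bad r =
      DaniCorrespondence.unip ⁻¹'
        (DaniCorrespondence.proj ⁻¹'
            DaniCorrespondence.boundedPoints (DaniCorrespondence.semiflow r) ∩
          Set.range DaniCorrespondence.unip) ∧
    ((∀ σ, 0 < r σ) →
      DaniCorrespondence.Bad r =
        DaniCorrespondence.unip ⁻¹'
          (DaniCorrespondence.proj ⁻¹'
              DaniCorrespondence.boundedPoints (DaniCorrespondence.semiflow r) ∩
            DaniCorrespondence.horospherical r)) := by
  have hr1 : ∀ σ, r σ ≤ 1 := fun σ =>
    (Finset.single_le_sum (fun τ _ => hr τ) (Finset.mem_univ σ)).trans_eq hsum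
  have h := DaniCorrespondence.isBadlyApproximable_iff_isBoundedSet hr hr1
  -- Under the preimage by `unip`, intersecting with `H` has no effect once every `unip x` lies in
  -- `H`; the reverse inclusion for the horospherical subgroup is not needed.
  refine ⟨h, ?_, fun hpos => ?_⟩
  · ext x
    exact (h x).trans ⟨fun hx => ⟨hx, x, rfl⟩, fun hx => hx.1⟩
  · ext x
    exact (h x).trans
      ⟨fun hx => ⟨hx, DaniCorrespondence.unip_mem_horospherical hpos x⟩, fun hx => hx.1⟩
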